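/- Let $T$ be a connected metric space that is a \emph{lifted space}: there are a homeomorphism $h$ from $\mathbb{R}$ onto its image in $T$ and a homeomorphism $\tau:T\to T$ such that (i) $\tau(h(x))=h(x+1)$ for all $x\in\mathbb{R}$; (ii) the closure of each connected component of $T\setminus h(\mathbb{R})$ is compact and meets $h(\mathbb{R})$ at a single point; (iii) only finitely many connected components $C$ of $T\setminus h(\mathbb{R})$ satisfy $\overline{C}\cap h([0,1])\neq\emptyset$. Fix such $h$ and $\tau$, identify $h(\mathbb{R})$ with $\mathbb{R}$, and write $x+k$ for $\tau^k(x)$ ($x\in T$, $k\in\mathbb{Z}$). Let $r:T\to\mathbb{R}$ be the natural retraction: $r(x)=x$ for $x\in\mathbb{R}$, and if $x$ lies in a connected component $C$ of $T\setminus\mathbb{R}$, then $r(x)$ is the unique point of $\overline{C}\cap\mathbb{R}$. Let $F:T\to T$ be continuous of degree one, that is, $F(x+1)=F(x)+1$ for all $x\in T$. Suppose that $F$ is \emph{combed}: for every $x\in\mathbb{R}$, the set $r(F(r^{-1}(x)))$ is contained both in $r(F(\{y\in\mathbb{R}: y\le x\}))$ and in $r(F(\{y\in\mathbb{R}: y\ge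 x\}))$. The rotation number of $x\in T$ is $\rho_F(x)=\lim_{n\to\infty}\frac{r(F^n(x))-r(x)}{n}$ whenever this limit exists (in $\mathbb{R}$), and $\mathrm{Rot}(F)$ is the set of all rotation numbers of points of $T$. A point $x\in T$ is periodic $(\mathrm{mod}\ 1)$ if $F^n(x)\in x+\mathbb{Z}$ for some $n\ge 1$, and its period $(\mathrm{mod}\ 1)$ is the least such $n$. Let $\mathrm{Per}(F)$ be the set of periods $(\mathrm{mod}\ 1)$ of all periodic $(\mathrm{mod}\ 1)$ points of $F$ in $T$, and for $\alpha\in\mathbb{R}$ let $\mathrm{Per}(\alpha,F)$ be the set of periods $(\mathrm{mod}\ 1)$ of those with rotation number $\alpha$. Let $\mathbb{N}=\{1,2,\dots\}$ and $M(a,b)=\{n\in\mathbb{N}: a<k/n<b \text{ for some } k\in\mathbb{Z}\}$. If $\mathrm{Rot}(F)=[a,b]$, then: (a) for all coprime $p\in\mathbb{Z}$, $q\in\mathbb{N}$ with $p/q\in(a,b)$, $\mathrm{Per}(p/q,F)=q\mathbb{N}=\{qm: m\in\mathbb{N}\}$; (b) $\mathrm{Per}(F)=\mathrm{Per}(a,F)\cup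 M(a,b)\cup\mathrm{Per}(b,F)$. -/

import Mathlib

/-- A lifted space structure on a metric space `T`: `T` is connected and carries a copy `h(ℝ)` of
the real line (`h` is a homeomorphism onto its image) together with a homeomorphism `τ` of `T`, the
"translation by 1". The connected components of `T \ h(ℝ)` are the sets
`connectedComponentIn (Set.range h)ᶜ x` with `x ∉ h(ℝ)`. -/
structure LiftedSpace (T : Type*) [MetricSpace T] where
  connected : ConnectedSpace T
  h : ℝ → T
  isEmbedding_h : Topology.IsEmbedding h
  τ : T ≃ₜ T
  τ_h : ∀ x : ℝ, τ (h x) = h (x + 1)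
  isCompact_closure : ∀ x : T, x ∉ Set.range h →
    IsCompact (closure (connectedComponentIn (Set.range h)ᶜ x))
  closure_inter : ∀ x : T, x ∉ Set.range h →
    ∃ z : ℝ, closure (connectedComponentIn (Set.range h)ᶜ x) ∩ Set.range h = {h z}
  finite_components : {C : Set T | (∃ x, x ∉ Set.range h ∧
    C = connectedComponentIn (Set.range h)ᶜ x) ∧
      (closure C ∩ h '' Set.Icc 0 1).Nonempty}.Finite

namespace LiftedSpace

variable {T : Type*} [MetricSpace T] (L : LiftedSpace T)

open Classical in
/-- The natural retraction of `T` to the real line, with `h(ℝ)` identified with `ℝ`: a point `h t`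
is sent to `t`, and a point of a component `C` of `T \ h(ℝ)` is sent to the `z` such that
`closure C` meets `h(ℝ)` exactly at `h z`. -/
noncomputable def r (x : T) : ℝ :=
  if hx : x ∈ Set.range L.h then hx.choose else (L.closure_inter x hx).choose

theorem r_h (t : ℝ) : L.r (L.h t) = t := by
  have hx : L.h t ∈ Set.range L.h := ⟨t, rfl⟩
  rw [r, dif_pos hx]
  exact L.isEmbedding_h.injective hx.choose_spec

theorem closure_inter_eq (x : T) (hx : x ∉ Set.range L.h) :
    closure (connectedComponentIn (Set.range L.h)ᶜ x) ∩ Set.range L.h = {L.h (L.r x)} := by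
  rw [r, dif_neg hx]
  exact (L.closure_inter x hx).choose_spec

/-- Continuous self-maps of `T` of degree one. -/
structure IsDegreeOne (F : T → T) : Prop where
  continuous : Continuous F
  map_τ : ∀ x, F (L.τ x) = L.τ (F x)

/-- `F` is left-combed at the point `x` of the real line. -/
def LeftCombedAt (F : T → T) (x : ℝ) : Prop :=
  (fun y => L.r (F y)) '' (L.r ⁻¹' {x}) ⊆ (fun y => L.r (F y)) '' (L.h '' Set.Iic x)

/-- `F` is right-combed at the point `x` of the real line. -/
def RightCombedAt (F : T → T) (x : ℝ) : Prop :=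
  (fun y => L.r (F y)) '' (L.r ⁻¹' {x}) ⊆ (fun y => L.r (F y)) '' (L.h '' Set.Ici x)

/-- `F` is combed: left-combed and right-combed at every point of the real line. -/
def Combed (F : T → T) : Prop :=
  ∀ x : ℝ, L.LeftCombedAt F x ∧ L.RightCombedAt F x

/-- The rotation number of `x` exists and equals `α`. -/
def HasRotationNumber (F : T → T) (x : T) (α : ℝ) : Prop :=
  Filter.Tendsto (fun n : ℕ => (L.r (F^[n] x) - L.r x) / (n : ℝ)) Filter.atTop (nhds α)

/-- The rotation set: all rotation numbers of points of `T` that have one. -/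
def Rot (F : T → T) : Set ℝ :=
  {α | ∃ x : T, L.HasRotationNumber F x α}

/-- `x` is periodic (mod 1) with period (mod 1) equal to `n`: `n` is the least positive integer
with `F^n(x) ∈ x + ℤ`, where `x + k` means `τ^k(x)`. -/
def HasPeriodModOne (F : T → T) (x : T) (n : ℕ) : Prop :=
  IsLeast {m : ℕ | 0 < m ∧ ∃ k : ℤ, F^[m] x = (L.τ ^ k : T ≃ₜ T) x} n

/-- The set of periods (mod 1) of `F`. -/
def Per (F : T → T) : Set ℕ :=
  {n | ∃ x : T, L.HasPeriodModOne F x n}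

/-- The set of periods (mod 1) of the periodic (mod 1) points of rotation number `α`. -/
def PerAt (α : ℝ) (F : T → T) : Set ℕ :=
  {n | ∃ x : T, L.HasPeriodModOne F x n ∧ L.HasRotationNumber F x α}

end LiftedSpace

/-- The set `M(a,b)` of positive integers `n` with `a < k/n < b` for some integer `k`. -/
def denomSet (a b : ℝ) : Set ℕ :=
  {n | 0 < n ∧ ∃ k : ℤ, a < (k : ℝ) / (n : ℝ) ∧ (k : ℝ) / (n : ℝ) < b}

open Set Filter Topology

/-! ### Continuous maps of the line of degree one -/

/-! The problem reduces to the line map `G = r ∘ F ∘ h`. Preimages of compact intervals under `r`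
are closed, and a Baire argument turns this into continuity of `r` along paths, so `G` is continuous
of degree one (`continuous_r_comp`).

Combedness lets every value `r (F^n t)` be realised as `G^n y` both with some `y ≤ r t` and with
some `y ≥ r t`. Let `a < p/q < b` and `f = G^q - p`. An invariant half-line `(-∞, x]` of `f` would
force all rotation numbers to be at most `p/q`, and an invariant `[x, ∞)` would force them to be at
least `p/q`. As `a` and `b` are attained, neither exists.

Without invariant half-lines `f` has a horseshoe of two disjoint intervals that positively cover
their hull (`exists_positive_horseshoe`), hence points of every period `m` at which `f^m` crosses
the diagonal upwards (`exists_upcrossing_periodic`). Upcrossing makes them genuine: if the `F`-orbit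
left the line, `G` would be locally constant there, and so would `G^(qm)` near the point
(`iterate_h_eq_of_upcrossing`). This gives period `qm` for `F`. Conversely, a periodic point with
`F^n x = x + k` has rotation number `k/n`, which restricts `n`. -/

theorem map_add_int_of_degree_one {f : ℝ → ℝ} (hf : ∀ x, f (x + 1) = f x + 1) (x : ℝ) (k : ℤ) :
    f (x + k) = f x + k := by
  induction k using Int.induction_on with
  | zero => simp
  | succ i ih => push_cast at ih ⊢; rw [← add_assoc, hf, ih]; ring
  | pred i ih =>
    push_cast at ih ⊢
    have := hf (x + (-i - 1))
    rw [show x + (-(i : ℝ) - 1) + 1 = x + -i by ring, ih] at this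
    linarith

theorem iterate_degree_one {f : ℝ → ℝ} (hf : ∀ x, f (x + 1) = f x + 1) (n : ℕ) (x : ℝ) :
    f^[n] (x + 1) = f^[n] x + 1 := by
  induction n with
  | zero => rfl
  | succ n ih => rw [Function.iterate_succ_apply', Function.iterate_succ_apply', ih, hf]

theorem exists_le_map_eq_of_degree_one {f : ℝ → ℝ} (hc : Continuous f)
    (hf : ∀ x, f (x + 1) = f x + 1) {y w : ℝ} (hw : w ≤ f y) : ∃ y' ≤ y, f y' = w := by
  obtain ⟨k, hk⟩ := exists_nat_ge (f y - w)
  have h1 : f (y - k) ≤ w := by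
    have := map_add_int_of_degree_one hf y (-k)
    push_cast at this
    rw [sub_eq_add_neg, this]; linarith
  have h2 : y - k ≤ y := by linarith [(Nat.cast_nonneg k : (0 : ℝ) ≤ k)]
  obtain ⟨y', hy', h⟩ := intermediate_value_Icc h2 hc.continuousOn ⟨h1, hw⟩
  exact ⟨y', hy'.2, h⟩

theorem exists_ge_map_eq_of_degree_one {f : ℝ → ℝ} (hc : Continuous f)
    (hf : ∀ x, f (x + 1) = f x + 1) {y w : ℝ} (hw : f y ≤ w) : ∃ y' ≥ y, f y' = w := by
  obtain ⟨k, hk⟩ := exists_nat_ge (w - f y)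
  have h1 : w ≤ f (y + k) := by
    have := map_add_int_of_degree_one hf y k
    push_cast at this
    rw [this]; linarith
  have h2 : y ≤ y + k := by linarith [(Nat.cast_nonneg k : (0 : ℝ) ≤ k)]
  obtain ⟨y', hy', h⟩ := intermediate_value_Icc h2 hc.continuousOn ⟨hw, h1⟩
  exact ⟨y', hy'.1, h⟩

/-- If no half-line `(-∞, x]` and no half-line `[x, ∞)` is invariant, a continuous degree one map of
the line has two disjoint intervals, each of them positively covering their convex hull. -/
theorem exists_positive_horseshoe {f : ℝ → ℝ} (hc : Continuous f)
    (hf : ∀ x, f (x + 1) = f x + 1) (hu : ∀ x, ∃ y ≤ x, x < f y) (hl : ∀ x, ∃ y ≥ x, f y < x) :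
    ∃ a₁ b₁ a₂ b₂ : ℝ, a₁ ≤ b₁ ∧ b₁ < a₂ ∧ a₂ ≤ b₂ ∧
      f a₁ ≤ a₁ ∧ b₂ ≤ f b₁ ∧ f a₂ ≤ a₁ ∧ b₂ ≤ f b₂ := by
  have hZ := map_add_int_of_degree_one hf
  have ivt : ∀ x y, x ≤ y → (f x ≤ x ∧ y ≤ f y ∨ x ≤ f x ∧ f y ≤ y) → ∃ z ∈ Icc x y, f z = z := by
    intro x y hxy h
    have hcc : ContinuousOn (fun z => f z - z) (Icc x y) := (hc.sub continuous_id).continuousOn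
    rcases h with h | h
    · obtain ⟨z, hz, hz'⟩ := intermediate_value_Icc hxy hcc
        (show (0 : ℝ) ∈ _ from ⟨by linarith, by linarith⟩)
      exact ⟨z, hz, by linarith⟩
    · obtain ⟨z, hz, hz'⟩ := intermediate_value_Icc' hxy hcc
        (show (0 : ℝ) ∈ _ from ⟨by linarith, by linarith⟩)
      exact ⟨z, hz, by linarith⟩
  have hfixclosed : IsClosed {x | f x = x} := isClosed_eq hc continuous_id
  -- An integer translation brings the point given by `hu` into `[q - 1, q)`; moving right only
  -- raises its image.
  have hup : ∀ q, f q = q → ∃ y, q - 1 ≤ y ∧ y < q ∧ q < f y := by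
    intro q hq
    obtain ⟨y, hy, hy'⟩ := hu q
    have hne : y < q := lt_of_le_of_ne hy (by rintro rfl; linarith)
    have h1 := Int.le_ceil (q - y)
    have h2 := Int.ceil_lt_add_one (q - y)
    have h3 : (1 : ℤ) ≤ ⌈q - y⌉ := Int.one_le_ceil_iff.2 (by linarith)
    have h3' : (1 : ℝ) ≤ ⌈q - y⌉ := by exact_mod_cast h3
    have h4 := hZ y (⌈q - y⌉ - 1)
    push_cast at h4
    exact ⟨y + (⌈q - y⌉ - 1), by linarith, by linarith, by linarith⟩
  have hdn : ∀ p, f p = p → ∃ v, v ≤ p + 1 ∧ p < v ∧ f v < p := by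
    intro p hp
    obtain ⟨y, hy, hy'⟩ := hl p
    have hne : p < y := lt_of_le_of_ne hy (by rintro rfl; linarith)
    have h1 := Int.le_ceil (y - p)
    have h2 := Int.ceil_lt_add_one (y - p)
    have h3 : (1 : ℤ) ≤ ⌈y - p⌉ := Int.one_le_ceil_iff.2 (by linarith)
    have h3' : (1 : ℝ) ≤ ⌈y - p⌉ := by exact_mod_cast h3
    have h4 := hZ y (-(⌈y - p⌉ - 1))
    push_cast at h4
    exact ⟨y + -(⌈y - p⌉ - 1), by linarith, by linarith, by linarith⟩
  -- Take the last fixed point `p` before `y`: a value below `p` on `[p, y]` would create a later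
  -- fixed point.
  have hlast : ∀ c y, f c = c → c ≤ y → y < f y →
      ∃ p, c ≤ p ∧ p ≤ y ∧ f p = p ∧ ∀ x ∈ Icc p y, p ≤ f x := by
    intro c y hcf hcy hy
    obtain ⟨p, ⟨⟨hp1, hp2⟩, hp⟩, hmax⟩ := (isCompact_Icc.inter_right hfixclosed).exists_isGreatest
      (⟨c, ⟨le_rfl, hcy⟩, hcf⟩ : (Icc c y ∩ {x | f x = x}).Nonempty)
    refine ⟨p, hp1, hp2, hp, fun x hx => ?_⟩
    by_contra! hlt
    obtain ⟨z, hz, hzf⟩ := ivt x y hx.2 (Or.inl ⟨by linarith [hx.1], hy.le⟩)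
    have : z ≤ p := hmax ⟨⟨by linarith [hx.1, hz.1], hz.2⟩, hzf⟩
    have : x = p := by linarith [hx.1, hz.1]
    subst this
    simp only [mem_ofPred_eq] at hp
    linarith
  have hfirst : ∀ c v, f c = c → v ≤ c → ∃ q, q ≤ c ∧ v ≤ q ∧ f q = q ∧
      ∀ z, v ≤ z → f z = z → q ≤ z := by
    intro c v hcf hcv
    obtain ⟨q, ⟨⟨hq1, hq2⟩, hq⟩, hmin⟩ := (isCompact_Icc.inter_right hfixclosed).exists_isLeast
      (⟨c, ⟨hcv, le_rfl⟩, hcf⟩ : (Icc v c ∩ {x | f x = x}).Nonempty)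
    refine ⟨q, hq2, hq1, hq, fun z hz hzf => ?_⟩
    rcases le_total z c with h | h
    · exact hmin ⟨⟨hz, h⟩, hzf⟩
    · linarith
  obtain ⟨q₀, hq₀⟩ : ∃ q, f q = q := by
    obtain ⟨x, hx, hx'⟩ := hu 0
    obtain ⟨y, hy, hy'⟩ := hl 0
    obtain ⟨z, -, hz⟩ := ivt x y (by linarith) (Or.inr ⟨by linarith, by linarith⟩)
    exact ⟨z, hz⟩
  -- triples `(p, y, q)` with `p`, `q` fixed and `[p, y]` mapped above `p` and reaching `q`
  let P : ℝ × ℝ × ℝ → Prop := fun t => t.1 ≤ t.2.1 ∧ t.2.1 ≤ t.2.2 ∧ t.2.2 ≤ t.1 + 1 ∧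
    f t.1 = t.1 ∧ f t.2.2 = t.2.2 ∧ t.2.2 ≤ f t.2.1 ∧
    -- Clamping `x` to `[p, y]` expresses a bound on a moving interval as an intersection of closed
    -- conditions.
    ∀ x, t.1 ≤ f (max t.1 (min x t.2.1))
  -- Integer translations allow `p ∈ [0, 1]`, which makes the set of triples compact.
  let K : Set (ℝ × ℝ × ℝ) := {t | t.1 ∈ Icc (0 : ℝ) 1 ∧ P t}
  have hKc : IsCompact K := by
    refine IsCompact.of_isClosed_subset
      ((isCompact_Icc (a := (0 : ℝ)) (b := 1)).prod
        ((isCompact_Icc (a := (0 : ℝ)) (b := 2)).prod (isCompact_Icc (a := (0 : ℝ)) (b := 2)))) ?_ ?_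
    · simp only [K, P, ofPred_and, ofPred_forall, mem_Icc]
      refine IsClosed.inter (IsClosed.inter ?_ ?_) (IsClosed.inter ?_ (IsClosed.inter ?_
        (IsClosed.inter ?_ (IsClosed.inter ?_ (IsClosed.inter ?_ (IsClosed.inter ?_
          (isClosed_iInter fun x => ?_)))))))
      all_goals first
        | exact isClosed_le (by fun_prop) (by fun_prop)
        | exact isClosed_eq (by fun_prop) (by fun_prop)
    · rintro ⟨p, y, q⟩ ⟨⟨h0, h1⟩, h2, h3, h4, -⟩
      simp only at h0 h1 h2 h3 h4
      exact ⟨⟨h0, h1⟩, ⟨by simp only; linarith, by simp only; linarith⟩,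
        ⟨by simp only; linarith, by simp only; linarith⟩⟩
  have hbuild : ∀ q p y, f q = q → f p = p → q - 1 ≤ p → p ≤ y → y ≤ q → q ≤ f y →
      (∀ x ∈ Icc p y, p ≤ f x) → ∃ t ∈ K, t.2.2 - t.1 = q - p := by
    intro q p y hq hp h1 h2 h3 h4 h5
    have e : ∀ x, f (x - ⌊p⌋) = f x - ⌊p⌋ := fun x => by
      have := hZ x (-⌊p⌋); push_cast at this; rw [sub_eq_add_neg, this]; ring
    refine ⟨(p - ⌊p⌋, y - ⌊p⌋, q - ⌊p⌋), ⟨⟨?_, ?_⟩, ?_, ?_, ?_, ?_, ?_, ?_, ?_⟩, ?_⟩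
    · simp only; linarith [Int.floor_le p]
    · simp only; linarith [Int.lt_floor_add_one p]
    · simp only; linarith
    · simp only; linarith
    · simp only; linarith
    · simp only [e, hp]
    · simp only [e, hq]
    · simp only [e]; linarith
    · intro x
      simp only
      have h6 : max (p - ⌊p⌋) (min x (y - ⌊p⌋)) = max p (min (x + ⌊p⌋) y) - ⌊p⌋ := by
        rw [← max_sub_sub_right, ← min_sub_sub_right]; simp
      rw [h6, e]
      have := h5 (max p (min (x + ⌊p⌋) y)) ⟨le_max_left _ _, max_le h2 (min_le_right _ _)⟩
      linarith
    · simp only; ring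
  have hA : ∀ q, f q = q → ∃ p y, f p = p ∧ q - 1 ≤ p ∧ p ≤ y ∧ y < q ∧ q < f y ∧
      ∀ x ∈ Icc p y, p ≤ f x := by
    intro q hq
    obtain ⟨y, hy1, hy2, hy3⟩ := hup q hq
    obtain ⟨p, hp1, hp2, hp3, hp4⟩ := hlast (q - 1) y
      (by have := hf (q - 1); rw [sub_add_cancel, hq] at this; linarith) hy1 (by linarith)
    exact ⟨p, y, hp3, hp1, hp2, hy2, hy3, hp4⟩
  obtain ⟨t₁, ht₁, hpos⟩ : ∃ t ∈ K, 0 < t.2.2 - t.1 := by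
    obtain ⟨p, y, h1, h2, h3, h4, h5, h6⟩ := hA q₀ hq₀
    obtain ⟨t, ht, he⟩ := hbuild q₀ p y hq₀ h1 h2 h3 h4.le h5.le h6
    exact ⟨t, ht, by linarith⟩
  -- Choose a triple with `q - p` maximal; `[p, y]` is the candidate for the left interval, and the
  -- right one is `[v, q₁]` below.
  obtain ⟨⟨p, y, q⟩, ⟨-, hpy, hyq, hqp, hp, hq, hyf, hmin⟩, hmax⟩ :=
    hKc.exists_isMaxOn ⟨t₁, ht₁⟩ (f := fun t => t.2.2 - t.1) (by fun_prop)
  simp only at hpy hyq hqp hp hq hyf hmin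
  have hpq : p < q := by have := hmax ht₁; simp only [mem_ofPred_eq] at this; linarith
  have hmin' : ∀ x ∈ Icc p y, p ≤ f x := fun x hx => by
    have := hmin x
    rwa [min_eq_left hx.2, max_eq_right hx.1] at this
  obtain ⟨v, hv1, hv2, hv3⟩ := hdn p hp
  have hyv : y < v := by
    by_contra! h
    exact absurd (hmin' v ⟨hv2.le, h⟩) (by linarith)
  have hp1 : f (p + 1) = p + 1 := by rw [hf, hp]
  obtain ⟨q₁, hq₁, hvq₁, hfq₁, hq₁min⟩ := hfirst (p + 1) v hp1 hv1
  rcases le_or_gt q₁ q with hle | hgt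
  · exact ⟨p, y, v, q₁, hpy, hyv, hvq₁, hp.le, by linarith, hv3.le, hfq₁.ge⟩
  -- If `q₁` lies beyond `q`, the left interval is rebuilt from `q₁`. Maximality forces `p ≤ p₂`,
  -- and `f v < p ≤ p₂` then keeps `[p₂, y₂]` to the left of `v`.
  obtain ⟨p₂, y₂, h1, h2, h3, h4, h5, h6⟩ := hA q₁ hfq₁
  rcases lt_or_ge p₂ p with hlt | hge
  · exfalso
    obtain ⟨t, ht, he⟩ := hbuild q₁ p₂ y₂ hfq₁ h1 h2 h3 h4.le h5.le h6
    have := hmax ht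
    simp only [mem_ofPred_eq] at this
    linarith
  · have hp₂v : p₂ < v := by
      by_contra! h
      have := hq₁min p₂ h h1
      linarith
    have : y₂ < v := by
      by_contra! h
      have := h6 v ⟨hp₂v.le, h⟩
      linarith
    exact ⟨p₂, y₂, v, q₁, h3, this, hvq₁, h1.le, h5.le, by linarith, hfq₁.ge⟩

/-- Stop at the first hit of `d`, then start from the last earlier hit of `c`. Orientation is
preserved, which the upcrossing later needs. -/
theorem exists_subinterval_map_eq {f : ℝ → ℝ} {a b c d : ℝ} (hab : a ≤ b)
    (hc : ContinuousOn f (Icc a b)) (hcd : c ≤ d) (ha : f a ≤ c) (hb : d ≤ f b) :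
    ∃ a' b', a ≤ a' ∧ a' ≤ b' ∧ b' ≤ b ∧ f a' = c ∧ f b' = d ∧ ∀ x ∈ Icc a' b', f x ∈ Icc c d := by
  have hclosed : IsClosed (Icc a b ∩ f ⁻¹' {d}) :=
    hc.preimage_isClosed_of_isClosed isClosed_Icc isClosed_singleton
  obtain ⟨z, hz, hzd⟩ := intermediate_value_Icc hab hc ⟨ha.trans hcd, hb⟩
  obtain ⟨b', ⟨⟨hb1, hb2⟩, hb'⟩, hbmin⟩ :=
    (isCompact_Icc.of_isClosed_subset hclosed inter_subset_left).exists_isLeast ⟨z, hz, hzd⟩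
  have hc' : ContinuousOn f (Icc a b') := hc.mono (Icc_subset_Icc_right hb2)
  have hclosed' : IsClosed (Icc a b' ∩ f ⁻¹' {c}) :=
    hc'.preimage_isClosed_of_isClosed isClosed_Icc isClosed_singleton
  obtain ⟨w, hw, hwc⟩ := intermediate_value_Icc hb1 hc' ⟨ha, hcd.trans hb'.ge⟩
  obtain ⟨a', ⟨⟨ha1, ha2⟩, ha'⟩, hamax⟩ :=
    (isCompact_Icc.of_isClosed_subset hclosed' inter_subset_left).exists_isGreatest ⟨w, hw, hwc⟩
  simp only [mem_preimage, mem_singleton_iff] at ha' hb'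
  refine ⟨a', b', ha1, ha2, hb2, ha', hb', fun x hx => ⟨?_, ?_⟩⟩
  · by_contra! h
    obtain ⟨s, hs, hsc⟩ := intermediate_value_Icc hx.2
      (hc'.mono (Icc_subset_Icc_left (ha1.trans hx.1))) ⟨h.le, by rw [hb']; exact hcd⟩
    have : s ≤ a' := hamax ⟨⟨ha1.trans (hx.1.trans hs.1), hs.2⟩, hsc⟩
    have : x = s := le_antisymm hs.1 (by linarith [hx.1])
    subst this
    exact h.ne hsc
  · by_contra! h
    obtain ⟨s, hs, hsc⟩ := intermediate_value_Icc hx.1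
      (hc'.mono (Icc_subset_Icc ha1 hx.2)) ⟨by rw [ha']; exact hcd, h.le⟩
    have : b' ≤ s := hbmin ⟨⟨ha1.trans hs.1, (hs.2.trans hx.2).trans hb2⟩, hsc⟩
    have : x = s := le_antisymm (by linarith [hx.2]) hs.2
    subst this
    exact h.ne' hsc

theorem exists_itinerary_of_positive_covering {f : ℝ → ℝ} (hc : Continuous f) {l u : ℕ → ℝ}
    (hlu : ∀ i, l i ≤ u i) (hl : ∀ i, f (l i) ≤ l (i + 1)) (hu : ∀ i, u (i + 1) ≤ f (u i)) (n : ℕ) :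
    ∃ a b, l 0 ≤ a ∧ a ≤ b ∧ b ≤ u 0 ∧ f^[n] a = l n ∧ f^[n] b = u n ∧
      ∀ x ∈ Icc a b, ∀ i ≤ n, f^[i] x ∈ Icc (l i) (u i) := by
  induction n with
  | zero =>
    refine ⟨l 0, u 0, le_rfl, hlu 0, le_rfl, rfl, rfl, fun x hx i hi => ?_⟩
    obtain rfl := Nat.le_zero.1 hi
    exact hx
  | succ n ih =>
    obtain ⟨a, b, h1, h2, h3, ha, hb, h⟩ := ih
    obtain ⟨a', b', h1', h2', h3', ha', hb', h'⟩ := exists_subinterval_map_eq (f := f^[n + 1]) h2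
      (hc.iterate _).continuousOn (hlu (n + 1))
      (by rw [Function.iterate_succ_apply', ha]; exact hl n)
      (by rw [Function.iterate_succ_apply', hb]; exact hu n)
    refine ⟨a', b', h1.trans h1', h2', h3'.trans h3, ha', hb', fun x hx i hi => ?_⟩
    rcases Nat.le_succ_iff.1 hi with hi | rfl
    · exact h x ⟨h1'.trans hx.1, hx.2.trans h3'⟩ i hi
    · exact h' x hx

/-- Periodic points of every period at which the iterate crosses the diagonal upwards. -/
theorem exists_upcrossing_periodic {f : ℝ → ℝ} (hc : Continuous f)
    (hf : ∀ x, f (x + 1) = f x + 1) (hu : ∀ x, ∃ y ≤ x, x < f y) (hl : ∀ x, ∃ y ≥ x, f y < x)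
    {m : ℕ} (hm : 0 < m) :
    ∃ x, f^[m] x = x ∧ (∀ d, 0 < d → d < m → f^[d] x ≠ x) ∧ ∀ᶠ y in 𝓝[>] x, y < f^[m] y := by
  obtain ⟨a₁, b₁, a₂, b₂, h₁, h₁₂, h₂, ha₁, hb₁, ha₂, hb₂⟩ := exists_positive_horseshoe hc hf hu hl
  -- Itinerary: left interval at time `0`, right interval at times `0 < i < m`, whole hull at time
  -- `m`.
  let l : ℕ → ℝ := fun i => if i = 0 then a₁ else if i < m then a₂ else a₁
  let u : ℕ → ℝ := fun i => if i = 0 then b₁ else b₂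
  obtain ⟨a, b, hla, hab, hbu, hfa, hfb, h⟩ := exists_itinerary_of_positive_covering hc
    (l := l) (u := u)
    (fun i => by simp only [l, u]; split_ifs <;> linarith)
    (fun i => by simp only [l]; split_ifs <;> first | omega | linarith)
    (fun i => by simp only [u]; split_ifs <;> first | omega | linarith) m
  have hl0 : l 0 = a₁ := by simp [l]
  have hlm : l m = a₁ := by simp [l]
  have hu0 : u 0 = b₁ := by simp [u]
  have hum : u m = b₂ := by simp [u, hm.ne']
  rw [hlm] at hfa
  rw [hum] at hfb
  rw [hl0] at hla
  rw [hu0] at hbu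
  have hcm : Continuous f^[m] := hc.iterate m
  -- The last point of `[a, b]` not moved to the right by `f^m` is fixed by it and is an upcrossing.
  obtain ⟨x, ⟨⟨hx1, hx2⟩, hx⟩, hmax⟩ :=
    (isCompact_Icc.inter_right (isClosed_le hcm continuous_id)).exists_isGreatest
      (⟨a, ⟨le_rfl, hab⟩, by simp [hfa, hla]⟩ : (Icc a b ∩ {x | f^[m] x ≤ id x}).Nonempty)
  simp only [id, mem_ofPred_eq] at hx
  have hxb : x < b := lt_of_le_of_ne hx2 (by rintro rfl; linarith)
  have hgt : ∀ᶠ y in 𝓝[>] x, y < f^[m] y := by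
    filter_upwards [Ioc_mem_nhdsGT hxb] with y hy
    by_contra! hle
    have : y ≤ x := hmax ⟨⟨hx1.trans hy.1.le, hy.2⟩, hle⟩
    linarith [hy.1]
  refine ⟨x, le_antisymm hx ?_, fun d hd hdm hdx => ?_, hgt⟩
  · exact le_of_tendsto_of_tendsto (tendsto_id.mono_left nhdsWithin_le_nhds)
      (hcm.continuousAt.tendsto.mono_left nhdsWithin_le_nhds) (hgt.mono fun y hy => hy.le)
  -- At times `0 < d < m` the orbit is at least `a₂ > b₁ ≥ x`.
  · have h0 := (h x ⟨hx1, hx2⟩ 0 (Nat.zero_le _)).2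
    have h3 := (h x ⟨hx1, hx2⟩ d hdm.le).1
    rw [hdx] at h3
    simp only [l, u, hd.ne', hdm, if_true, if_false, Function.iterate_zero, id] at h0 h3
    linarith

/-! ### A closed graph criterion for continuity on the line -/

/-- Within a bound `N`, the values at distance at least `ε` from `g x` form two compact intervals,
whose closed preimages miss `x`. -/
theorem continuousAt_of_eventually_abs_le {g : ℝ → ℝ}
    (hg : ∀ a b, IsClosed (g ⁻¹' Icc a b)) {x N : ℝ} (hN : ∀ᶠ y in 𝓝 x, |g y| ≤ N) :
    ContinuousAt g x := by
  rw [Metric.continuousAt_iff']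
  intro ε hε
  have h1 : x ∉ g ⁻¹' Icc (-N) (g x - ε) := fun h => by linarith [h.2]
  have h2 : x ∉ g ⁻¹' Icc (g x + ε) N := fun h => by linarith [h.1]
  filter_upwards [hN, (hg _ _).isOpen_compl.mem_nhds h1, (hg _ _).isOpen_compl.mem_nhds h2]
    with y hy hy1 hy2
  simp only [mem_compl_iff, mem_preimage, mem_Icc, not_and, not_le] at hy1 hy2
  rw [Real.dist_eq, abs_lt]
  have := abs_le.1 hy
  constructor
  · linarith [hy1 this.1]
  · by_contra! h
    linarith [hy2 (by linarith)]

/-- On `(u, t]` the sign of `g` is constant. Closed preimages of bounded intervals missing `u` then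
force `g` to an infinite limit at `u`, which is excluded. -/
theorem false_of_right_gap {g : ℝ → ℝ} (hg : ∀ a b, IsClosed (g ⁻¹' Icc a b))
    (htop : ∀ u t, u < t → ContinuousOn g (Ioc u t) → ¬ Tendsto g (𝓝[>] u) atTop)
    (hbot : ∀ u t, u < t → ContinuousOn g (Ioc u t) → ¬ Tendsto g (𝓝[>] u) atBot)
    {u t n : ℝ} (hut : u < t) (hc : ContinuousOn g (Ioc u t)) (hn : 0 ≤ n) (hu : |g u| ≤ n)
    (hgap : ∀ s ∈ Ioc u t, n + 1 < |g s|) : False := by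
  have hu' := abs_le.1 hu
  rcases lt_abs.1 (hgap t ⟨hut, le_rfl⟩) with ht | ht
  · have hpos : ∀ s ∈ Ioc u t, n + 1 < g s := by
      intro s hs
      rcases lt_abs.1 (hgap s hs) with h | h
      · exact h
      obtain ⟨z, hz, hz0⟩ := intermediate_value_Icc hs.2
        (hc.mono fun z hz => ⟨hs.1.trans_le hz.1, hz.2⟩)
        (show (0 : ℝ) ∈ Icc (g s) (g t) from ⟨by linarith, by linarith⟩)
      have := hgap z ⟨hs.1.trans_le hz.1, hz.2⟩
      rw [hz0, abs_zero] at this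
      linarith
    refine htop u t hut hc (tendsto_atTop.2 fun B => ?_)
    have h1 : u ∉ g ⁻¹' Icc (n + 1) B := fun h => by linarith [h.1]
    filter_upwards [Ioc_mem_nhdsGT hut,
      mem_nhdsWithin_of_mem_nhds ((hg _ _).isOpen_compl.mem_nhds h1)] with s hs hs'
    by_contra! h
    exact hs' ⟨(hpos s hs).le, h.le⟩
  · have hneg : ∀ s ∈ Ioc u t, n + 1 < -g s := by
      intro s hs
      rcases lt_abs.1 (hgap s hs) with h | h
      · obtain ⟨z, hz, hz0⟩ := intermediate_value_Icc' hs.2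
          (hc.mono fun z hz => ⟨hs.1.trans_le hz.1, hz.2⟩)
          (show (0 : ℝ) ∈ Icc (g t) (g s) from ⟨by linarith, by linarith⟩)
        have := hgap z ⟨hs.1.trans_le hz.1, hz.2⟩
        rw [hz0, abs_zero] at this
        linarith
      · exact h
    refine hbot u t hut hc (tendsto_atBot.2 fun B => ?_)
    have h1 : u ∉ g ⁻¹' Icc B (-(n + 1)) := fun h => by linarith [h.2]
    filter_upwards [Ioc_mem_nhdsGT hut,
      mem_nhdsWithin_of_mem_nhds ((hg _ _).isOpen_compl.mem_nhds h1)] with s hs hs'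
    by_contra! h
    exact hs' ⟨h.le, by linarith [hneg s hs]⟩

/-- Right of a point `e` of local unboundedness, near which `g` is bounded by `n` on the set of all
such points, values above `n + 1` are impossible close to `e`. -/
theorem eventually_abs_le_right {g : ℝ → ℝ} (hg : ∀ a b, IsClosed (g ⁻¹' Icc a b))
    (htop : ∀ u t, u < t → ContinuousOn g (Ioc u t) → ¬ Tendsto g (𝓝[>] u) atTop)
    (hbot : ∀ u t, u < t → ContinuousOn g (Ioc u t) → ¬ Tendsto g (𝓝[>] u) atBot)
    {E : Set ℝ} (hE : IsClosed E) (hcE : ∀ x ∉ E, ContinuousAt g x) {e n : ℝ} (hn : 0 ≤ n)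
    (heE : e ∈ E) (hbd : ∀ᶠ y in 𝓝 e, y ∈ E → |g y| ≤ n) :
    ∀ᶠ t in 𝓝[>] e, |g t| ≤ n + 1 := by
  have he := abs_le.1 (hbd.self_of_nhds heE)
  have h1 : e ∉ g ⁻¹' Icc (n + 1) (n + 1) := fun h => by linarith [h.1]
  have h2 : e ∉ g ⁻¹' Icc (-(n + 1)) (-(n + 1)) := fun h => by linarith [h.2]
  obtain ⟨δ, hδ, hball⟩ := Metric.eventually_nhds_iff.1 (hbd.and
    (((hg _ _).isOpen_compl.eventually_mem h1).and ((hg _ _).isOpen_compl.eventually_mem h2)))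
  filter_upwards [Ioo_mem_nhdsGT (show e < e + δ by linarith)] with t ht
  by_contra! hgt
  have hclose : ∀ y ∈ Icc e t, dist y e < δ := fun y hy => by
    rw [Real.dist_eq, abs_lt]; constructor <;> linarith [hy.1, hy.2, ht.2]
  -- Past the last point `u` of `E` before `t`, `g` is continuous and avoids `±(n + 1)`, so `|g|`
  -- stays above `n + 1` down to `u`.
  obtain ⟨u, ⟨⟨hu1, hu2⟩, huE⟩, humax⟩ := (isCompact_Icc.inter_right hE).exists_isGreatest
    (⟨e, ⟨le_rfl, ht.1.le⟩, heE⟩ : (Icc e t ∩ E).Nonempty)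
  have hgu := (hball (hclose u ⟨hu1, hu2⟩)).1 huE
  have hut : u < t := lt_of_le_of_ne hu2 (by rintro rfl; linarith)
  have hc : ContinuousOn g (Ioc u t) := fun s hs => (hcE s fun hsE => by
    have : s ≤ u := humax ⟨⟨hu1.trans hs.1.le, hs.2⟩, hsE⟩
    linarith [hs.1]).continuousWithinAt
  refine false_of_right_gap hg htop hbot hut hc hn hgu fun s hs => ?_
  by_contra! hle
  obtain ⟨z, hz, hzn⟩ := intermediate_value_Icc hs.2
    (hc.abs.mono fun z hz => ⟨hs.1.trans_le hz.1, hz.2⟩) ⟨hle, hgt.le⟩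
  have hz' := (hball (hclose z ⟨hu1.trans (hs.1.le.trans hz.1), hz.2⟩)).2
  rcases (abs_eq (by linarith)).1 hzn with h | h
  · exact hz'.1 ⟨h.ge, h.le⟩
  · exact hz'.2 ⟨h.ge, h.le⟩

/-- A real function for which preimages of compact intervals are closed is continuous as soon as it
never tends to infinity at an end point of an interval of continuity. -/
theorem continuous_of_isClosed_preimage_Icc {g : ℝ → ℝ} (hg : ∀ a b, IsClosed (g ⁻¹' Icc a b))
    (htop : ∀ u t, u < t → ContinuousOn g (Ioc u t) → ¬ Tendsto g (𝓝[>] u) atTop)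
    (hbot : ∀ u t, u < t → ContinuousOn g (Ioc u t) → ¬ Tendsto g (𝓝[>] u) atBot)
    (htop' : ∀ u t, u < t → ContinuousOn (fun x => g (-x)) (Ioc u t) →
      ¬ Tendsto (fun x => g (-x)) (𝓝[>] u) atTop)
    (hbot' : ∀ u t, u < t → ContinuousOn (fun x => g (-x)) (Ioc u t) →
      ¬ Tendsto (fun x => g (-x)) (𝓝[>] u) atBot) :
    Continuous g := by
  let O : Set ℝ := {x | ∃ N : ℝ, ∀ᶠ y in 𝓝 x, |g y| ≤ N}
  have hO : IsOpen O := by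
    rw [isOpen_iff_mem_nhds]
    rintro x ⟨N, hN⟩
    filter_upwards [eventually_eventually_nhds.2 hN] with y hy using ⟨N, hy⟩
  have hcO : ∀ x ∉ Oᶜ, ContinuousAt g x := fun x hx => by
    obtain ⟨N, hN⟩ := not_notMem.1 hx
    exact continuousAt_of_eventually_abs_le hg hN
  rw [continuous_iff_continuousAt]
  by_contra! hne
  obtain ⟨x₀, hx₀⟩ := hne
  have : Nonempty ↥(Oᶜ) := ⟨⟨x₀, fun h => hx₀ (hcO x₀ fun h' => h' h)⟩⟩
  have : CompleteSpace ↥(Oᶜ) := hO.isClosed_compl.completeSpace_coe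
  -- Baire on the closed set of points of local unboundedness: `g` is bounded on a relatively open
  -- piece of it.
  obtain ⟨n, ⟨e, heE⟩, he⟩ := nonempty_interior_of_iUnion_of_closed (X := ↥(Oᶜ))
    (f := fun n : ℕ => Subtype.val ⁻¹' (g ⁻¹' Icc (-(n : ℝ)) n))
    (fun n => (hg _ _).preimage continuous_subtype_val) (by
      refine eq_univ_of_forall fun x => mem_iUnion.2 ?_
      obtain ⟨n, hn⟩ := exists_nat_ge |g x|
      exact ⟨n, abs_le.1 hn⟩)
  have hbd : ∀ᶠ y in 𝓝 e, y ∈ Oᶜ → |g y| ≤ n := by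
    have := mem_interior_iff_mem_nhds.1 he
    rw [nhds_subtype_eq_comap, mem_comap] at this
    obtain ⟨V, hV, hVs⟩ := this
    filter_upwards [hV] with y hy hyO
    exact abs_le.2 (hVs (show (⟨y, hyO⟩ : ↥(Oᶜ)) ∈ Subtype.val ⁻¹' V from hy))
  have hr := eventually_abs_le_right hg htop hbot hO.isClosed_compl hcO n.cast_nonneg heE hbd
  have hl := eventually_abs_le_right (g := fun x => g (-x)) (E := (fun x => -x) ⁻¹' Oᶜ) (e := -e)
    (fun a b => (hg a b).preimage continuous_neg) htop' hbot'
    (hO.isClosed_compl.preimage continuous_neg)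
    (fun x hx => ContinuousAt.comp (g := g) (hcO (-x) hx) continuous_neg.continuousAt)
    n.cast_nonneg (by simpa using heE)
    (by
      have : Tendsto (fun x : ℝ => -x) (𝓝 (-e)) (𝓝 e) := by
        simpa using (continuous_neg (G := ℝ)).tendsto (-e)
      exact this.eventually hbd)
  have hl' : ∀ᶠ t in 𝓝[<] e, |g t| ≤ n + 1 := by
    have : Tendsto (fun x : ℝ => -x) (𝓝[<] e) (𝓝[>] (-e)) := tendsto_neg_nhdsLT
    simpa using this.eventually hl
  refine heE ⟨n + 1, ?_⟩
  have h0 : |g e| ≤ n + 1 := (hbd.self_of_nhds heE).trans (by linarith)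
  have h3 : ∀ᶠ t in 𝓝[≠] e, |g t| ≤ n + 1 := by
    rw [← Iio_union_Ioi, nhdsWithin_union]
    exact eventually_sup.2 ⟨hl', hr⟩
  have := (eventually_nhdsWithin_iff.1 h3)
  filter_upwards [this] with y hy
  by_cases h : y = e
  · rwa [h]
  · exact hy h

namespace LiftedSpace

variable {T : Type*} [MetricSpace T] (L : LiftedSpace T)

/-! ### The retraction -/

theorem h_r {x : T} (hx : x ∈ range L.h) : L.h (L.r x) = x := by
  obtain ⟨t, rfl⟩ := hx
  rw [L.r_h]

theorem r_eq_of_mem_component {x y : T} (hx : x ∉ range L.h)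
    (hy : y ∈ connectedComponentIn (range L.h)ᶜ x) : L.r y = L.r x := by
  have hy' : y ∉ range L.h := connectedComponentIn_subset _ _ hy
  have h1 := L.closure_inter_eq y hy'
  rw [← connectedComponentIn_eq hy, L.closure_inter_eq x hx] at h1
  exact (L.isEmbedding_h.injective (singleton_injective h1)).symm

theorem image_τ_range : L.τ '' range L.h = range L.h := by
  ext x
  constructor
  · rintro ⟨_, ⟨t, rfl⟩, rfl⟩
    exact ⟨t + 1, (L.τ_h t).symm⟩
  · rintro ⟨t, rfl⟩
    exact ⟨_, ⟨t - 1, rfl⟩, by rw [L.τ_h, sub_add_cancel]⟩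

theorem r_τ (x : T) : L.r (L.τ x) = L.r x + 1 := by
  by_cases hx : x ∈ range L.h
  · obtain ⟨t, rfl⟩ := hx
    rw [L.τ_h, L.r_h, L.r_h]
  · have hx' : L.τ x ∉ range L.h := by
      rw [← L.image_τ_range]
      rintro ⟨y, hy, hxy⟩
      exact hx (L.τ.injective hxy ▸ hy)
    have h1 := congrArg (fun s => L.τ '' s) (L.closure_inter_eq x hx)
    rw [image_inter L.τ.injective, L.τ.image_closure, L.image_τ_range,
      L.τ.image_connectedComponentIn (show x ∈ (range L.h)ᶜ from hx),
      image_compl_eq L.τ.bijective, L.image_τ_range, L.closure_inter_eq _ hx', image_singleton,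
      L.τ_h] at h1
    exact L.isEmbedding_h.injective (singleton_injective h1)

theorem r_τ_zpow (k : ℤ) (x : T) : L.r ((L.τ ^ k : T ≃ₜ T) x) = L.r x + k := by
  induction k using Int.induction_on with
  | zero => simp
  | succ i ih =>
    rw [add_comm, zpow_add, zpow_one, Homeomorph.mul_apply, L.r_τ, ih]; push_cast; ring
  | pred i ih =>
    have h1 : (L.τ ^ (-(i : ℤ)) : T ≃ₜ T) x = L.τ ((L.τ ^ (-(i : ℤ) - 1) : T ≃ₜ T) x) := by
      rw [← Homeomorph.mul_apply, ← zpow_one_add]; congr 2; ring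
    rw [h1, L.r_τ] at ih
    push_cast at ih ⊢
    linarith

theorem τ_zpow_h (k : ℤ) (t : ℝ) : (L.τ ^ k : T ≃ₜ T) (L.h t) = L.h (t + k) := by
  induction k using Int.induction_on with
  | zero => simp
  | succ i ih =>
    rw [add_comm, zpow_add, zpow_one, Homeomorph.mul_apply, ih, L.τ_h]; push_cast; ring_nf
  | pred i ih =>
    apply L.τ.injective
    have h1 : (L.τ ^ (-(i : ℤ)) : T ≃ₜ T) (L.h t) = L.τ ((L.τ ^ (-(i : ℤ) - 1) : T ≃ₜ T) (L.h t)) := by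
      rw [← Homeomorph.mul_apply, ← zpow_one_add]; congr 2; ring
    rw [← h1, ih, L.τ_h]; push_cast; ring_nf

/-- The components of the complement of the line that are attached at a point of `[0, 1]`. -/
def unitComponents : Set (Set T) :=
  {C : Set T | (∃ x, x ∉ range L.h ∧ C = connectedComponentIn (range L.h)ᶜ x) ∧
    (closure C ∩ L.h '' Icc 0 1).Nonempty}

theorem r_eq_of_mem_closure {x : T} (hx : x ∉ range L.h) {y : T}
    (hy : y ∈ closure (connectedComponentIn (range L.h)ᶜ x)) : L.r y = L.r x := by
  by_cases hyr : y ∈ range L.h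
  · have : y ∈ ({L.h (L.r x)} : Set T) := by rw [← L.closure_inter_eq x hx]; exact ⟨hy, hyr⟩
    rw [mem_singleton_iff.1 this, L.r_h]
  · apply L.r_eq_of_mem_component hx
    have hpre : IsPreconnected (insert y (connectedComponentIn (range L.h)ᶜ x)) :=
      isPreconnected_connectedComponentIn.subset_closure (subset_insert _ _)
        (insert_subset hy subset_closure)
    exact hpre.subset_connectedComponentIn
      (mem_insert_of_mem _ (mem_connectedComponentIn (show x ∈ (range L.h)ᶜ from hx)))
      (insert_subset hyr (connectedComponentIn_subset _ _)) (mem_insert _ _)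

theorem component_mem_unitComponents {x : T} (hx : x ∉ range L.h) (h01 : L.r x ∈ Icc (0 : ℝ) 1) :
    connectedComponentIn (range L.h)ᶜ x ∈ L.unitComponents := by
  refine ⟨⟨x, hx, rfl⟩, L.h (L.r x), ?_, mem_image_of_mem _ h01⟩
  have : L.h (L.r x) ∈ closure (connectedComponentIn (range L.h)ᶜ x) ∩ range L.h := by
    rw [L.closure_inter_eq x hx]; rfl
  exact this.1

/-- The preimage is a compact arc together with finitely many closures of components. -/
theorem isClosed_preimage_r_unit {a b : ℝ} (ha : 0 ≤ a) (hb : b ≤ 1) :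
    IsClosed (L.r ⁻¹' Icc a b) := by
  have heq : L.r ⁻¹' Icc a b = L.h '' Icc a b ∪
      ⋃ C ∈ {C ∈ L.unitComponents | ∀ y ∈ closure C, L.r y ∈ Icc a b}, closure C := by
    ext x
    simp only [mem_preimage, mem_union, mem_iUnion, exists_prop]
    constructor
    · intro hx
      by_cases hxr : x ∈ range L.h
      · exact Or.inl ⟨_, hx, L.h_r hxr⟩
      · refine Or.inr ⟨_, ⟨L.component_mem_unitComponents hxr ⟨ha.trans hx.1, hx.2.trans hb⟩, ?_⟩,
          subset_closure (mem_connectedComponentIn (show x ∈ (range L.h)ᶜ from hxr))⟩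
        intro y hy
        rw [L.r_eq_of_mem_closure hxr hy]
        exact hx
    · rintro (⟨t, ht, rfl⟩ | ⟨C, ⟨-, hC⟩, hx⟩)
      · rwa [L.r_h]
      · exact hC x hx
  rw [heq]
  exact (isCompact_Icc.image L.isEmbedding_h.continuous).isClosed.union
    ((L.finite_components.subset (sep_subset _ _)).isClosed_biUnion fun C _ => isClosed_closure)

theorem isClosed_preimage_r (a b : ℝ) : IsClosed (L.r ⁻¹' Icc a b) := by
  have heq : L.r ⁻¹' Icc a b = ⋃ k ∈ Icc ⌊a⌋ ⌊b⌋,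
      (L.τ ^ (-k) : T ≃ₜ T) ⁻¹' (L.r ⁻¹' Icc (max (a - k) 0) (min (b - k) 1)) := by
    ext x
    simp only [mem_preimage, mem_iUnion, exists_prop, L.r_τ_zpow, mem_Icc, max_le_iff, le_min_iff]
    push_cast
    constructor
    · rintro ⟨h1, h2⟩
      exact ⟨⌊L.r x⌋, ⟨Int.floor_mono h1, Int.floor_mono h2⟩,
        ⟨by linarith, by linarith [Int.floor_le (L.r x)]⟩,
        by linarith, by linarith [Int.lt_floor_add_one (L.r x)]⟩
    · rintro ⟨k, -, ⟨h1, -⟩, h2, -⟩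
      exact ⟨by linarith, by linarith⟩
  rw [heq]
  exact (finite_Icc _ _).isClosed_biUnion fun k _ =>
    (L.isClosed_preimage_r_unit (le_max_right _ _) (min_le_right _ _)).preimage
      (L.τ ^ (-k) : T ≃ₜ T).continuous

/-- Some point of the line and all its translates carry no component. -/
theorem exists_unbranched : ∃ x₀ : ℝ, ∀ (k : ℤ) (x : T), L.r x = x₀ + k → x = L.h (x₀ + k) := by
  have hfin : (⋃ C ∈ L.unitComponents, L.r '' closure C).Finite := by
    refine L.finite_components.biUnion ?_
    rintro _ ⟨⟨x, hx, rfl⟩, -⟩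
    refine (finite_singleton (L.r x)).subset ?_
    rintro _ ⟨y, hy, rfl⟩
    exact L.r_eq_of_mem_closure hx hy
  obtain ⟨x₀, hx₀, hn⟩ := ((Icc_infinite (zero_lt_one (α := ℝ))).sdiff hfin).nonempty
  have key : ∀ x, L.r x = x₀ → x ∈ range L.h := by
    intro x hx
    by_contra hxr
    refine hn (mem_iUnion₂.2 ⟨_, L.component_mem_unitComponents hxr (hx ▸ hx₀), x, ?_, hx⟩)
    exact subset_closure (mem_connectedComponentIn (show x ∈ (range L.h)ᶜ from hxr))
  refine ⟨x₀, fun k x hx => ?_⟩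
  have h1 : L.r ((L.τ ^ (-k) : T ≃ₜ T) x) = x₀ := by rw [L.r_τ_zpow, hx]; push_cast; ring
  have h2 := L.h_r (key _ h1)
  rw [h1] at h2
  rw [← L.τ_zpow_h, h2, ← Homeomorph.mul_apply, ← zpow_add]
  simp

/-! ### The retraction along paths -/

theorem τ_ne_self (x : T) : L.τ x ≠ x := fun h => by
  have := L.r_τ x
  rw [h] at this
  linarith

/-- Escaping to infinity, the path would cross every far unbranched point `h (x₀ + k)` arbitrarily
close to time `u`. These points would converge to `γ u`, making it a fixed point of `τ`. -/
theorem not_tendsto_r_atTop {γ : ℝ → T} (hγ : Continuous γ) {u t : ℝ} (hut : u < t)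
    (hc : ContinuousOn (fun s => L.r (γ s)) (Ioc u t)) :
    ¬ Tendsto (fun s => L.r (γ s)) (𝓝[>] u) atTop := by
  intro hlim
  obtain ⟨x₀, hx₀⟩ := L.exists_unbranched
  have key : Tendsto (fun k : ℕ => L.h (x₀ + k)) atTop (𝓝 (γ u)) := by
    intro V hV
    have hV' : ∀ᶠ s in 𝓝[>] u, ∀ s' ∈ Ioc u s, γ s' ∈ V := by
      obtain ⟨δ, hδ, hball⟩ := Metric.eventually_nhds_iff.1 (hγ.continuousAt.eventually_mem hV)
      filter_upwards [Ioo_mem_nhdsGT (show u < u + δ by linarith)] with s hs s' hs'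
      apply hball
      rw [Real.dist_eq, abs_lt]
      constructor <;> linarith [hs'.1, hs'.2, hs.2]
    obtain ⟨s, hs, hsV⟩ := (Eventually.and (Ioc_mem_nhdsGT hut) hV').exists
    obtain ⟨K, hK⟩ := exists_nat_ge (L.r (γ s) - x₀)
    refine mem_map.2 (mem_atTop_sets.2 ⟨K, fun k hk => ?_⟩)
    have hk' : (K : ℝ) ≤ k := by exact_mod_cast hk
    obtain ⟨w, hw, hwk⟩ :=
      (Eventually.and (Ioc_mem_nhdsGT hs.1) (hlim.eventually_ge_atTop (x₀ + k))).exists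
    obtain ⟨z, hz, hzk⟩ := intermediate_value_Icc' hw.2
      (hc.mono fun z hz => ⟨hw.1.trans_le hz.1, hz.2.trans hs.2⟩)
      (show x₀ + k ∈ Icc _ _ from ⟨by linarith, hwk⟩)
    have := hx₀ k (γ z) (by simpa using hzk)
    simp only [Int.cast_natCast] at this
    rw [mem_preimage, ← this]
    exact hsV z ⟨hw.1.trans_le hz.1, hz.2⟩
  refine L.τ_ne_self (γ u) (tendsto_nhds_unique ((L.τ.continuous.tendsto _).comp key) ?_)
  refine (key.comp (tendsto_add_atTop_nat 1)).congr fun k => ?_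
  simp only [Function.comp_apply, L.τ_h]
  push_cast
  ring_nf

theorem not_tendsto_r_atBot {γ : ℝ → T} (hγ : Continuous γ) {u t : ℝ} (hut : u < t)
    (hc : ContinuousOn (fun s => L.r (γ s)) (Ioc u t)) :
    ¬ Tendsto (fun s => L.r (γ s)) (𝓝[>] u) atBot := by
  intro hlim
  obtain ⟨x₀, hx₀⟩ := L.exists_unbranched
  have key : Tendsto (fun k : ℕ => L.h (x₀ - k)) atTop (𝓝 (γ u)) := by
    intro V hV
    have hV' : ∀ᶠ s in 𝓝[>] u, ∀ s' ∈ Ioc u s, γ s' ∈ V := by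
      obtain ⟨δ, hδ, hball⟩ := Metric.eventually_nhds_iff.1 (hγ.continuousAt.eventually_mem hV)
      filter_upwards [Ioo_mem_nhdsGT (show u < u + δ by linarith)] with s hs s' hs'
      apply hball
      rw [Real.dist_eq, abs_lt]
      constructor <;> linarith [hs'.1, hs'.2, hs.2]
    obtain ⟨s, hs, hsV⟩ := (Eventually.and (Ioc_mem_nhdsGT hut) hV').exists
    obtain ⟨K, hK⟩ := exists_nat_ge (x₀ - L.r (γ s))
    refine mem_map.2 (mem_atTop_sets.2 ⟨K, fun k hk => ?_⟩)
    have hk' : (K : ℝ) ≤ k := by exact_mod_cast hk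
    obtain ⟨w, hw, hwk⟩ :=
      (Eventually.and (Ioc_mem_nhdsGT hs.1) (hlim.eventually_le_atBot (x₀ - k))).exists
    obtain ⟨z, hz, hzk⟩ := intermediate_value_Icc hw.2
      (hc.mono fun z hz => ⟨hw.1.trans_le hz.1, hz.2.trans hs.2⟩)
      (show x₀ - k ∈ Icc _ _ from ⟨hwk, by linarith⟩)
    have := hx₀ (-k) (γ z) (by simpa [sub_eq_add_neg] using hzk)
    simp only [Int.cast_neg, Int.cast_natCast, ← sub_eq_add_neg] at this
    rw [mem_preimage, ← this]
    exact hsV z ⟨hw.1.trans_le hz.1, hz.2⟩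
  refine L.τ_ne_self (γ u) (tendsto_nhds_unique ((L.τ.continuous.tendsto _).comp
    (key.comp (tendsto_add_atTop_nat 1))) (key.congr fun k => ?_))
  simp only [Function.comp_apply, L.τ_h]
  push_cast
  ring_nf

/-- The retraction need not be continuous on `T`, but it is continuous along every path. -/
theorem continuous_r_comp {γ : ℝ → T} (hγ : Continuous γ) : Continuous fun s => L.r (γ s) :=
  continuous_of_isClosed_preimage_Icc (fun a b => (L.isClosed_preimage_r a b).preimage hγ)
    (fun _ _ hut hc => L.not_tendsto_r_atTop hγ hut hc)
    (fun _ _ hut hc => L.not_tendsto_r_atBot hγ hut hc)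
    (fun _ _ hut hc => L.not_tendsto_r_atTop (hγ.comp continuous_neg) hut hc)
    (fun _ _ hut hc => L.not_tendsto_r_atBot (hγ.comp continuous_neg) hut hc)

theorem eventually_r_comp_eq {γ : ℝ → T} (hγ : Continuous γ) {t : ℝ} (ht : γ t ∉ range L.h) :
    ∀ᶠ s in 𝓝 t, L.r (γ s) = L.r (γ t) := by
  -- Continuity of `r ∘ γ` makes lying on the line a closed condition along the path, so the path
  -- stays in one component near `t`.
  have hclosed : IsClosed {s | L.h (L.r (γ s)) = γ s} :=
    isClosed_eq (L.isEmbedding_h.continuous.comp (L.continuous_r_comp hγ)) hγ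
  obtain ⟨δ, hδ, hball⟩ := Metric.eventually_nhds_iff_ball.1 (hclosed.isOpen_compl.mem_nhds
    (show t ∈ {s | L.h (L.r (γ s)) = γ s}ᶜ from fun h => ht ⟨_, h⟩) : ∀ᶠ s in 𝓝 t, _)
  filter_upwards [Metric.ball_mem_nhds t hδ] with s hs
  apply L.r_eq_of_mem_component ht
  have hpre : IsPreconnected (γ '' Metric.ball t δ) :=
    (convex_ball t δ).isPreconnected.image _ hγ.continuousOn
  refine hpre.subset_connectedComponentIn ⟨t, Metric.mem_ball_self hδ, rfl⟩ ?_ ⟨s, hs, rfl⟩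
  rintro _ ⟨s', hs', rfl⟩ hr
  exact hball s' hs' (L.h_r hr)

end LiftedSpace

namespace LiftedSpace

variable {T : Type*} [MetricSpace T] (L : LiftedSpace T)

/-! ### The induced map of the line -/

/-- The map `r ∘ F` restricted to the line. -/
noncomputable def lineMap (F : T → T) (x : ℝ) : ℝ := L.r (F (L.h x))

variable {L} {F : T → T}

theorem IsDegreeOne.continuous_lineMap (hF : L.IsDegreeOne F) : Continuous (L.lineMap F) :=
  L.continuous_r_comp (hF.continuous.comp L.isEmbedding_h.continuous)

theorem IsDegreeOne.lineMap_add_one (hF : L.IsDegreeOne F) (x : ℝ) :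
    L.lineMap F (x + 1) = L.lineMap F x + 1 := by
  rw [lineMap, ← L.τ_h, hF.map_τ, L.r_τ, lineMap]

theorem IsDegreeOne.map_τ_zpow (hF : L.IsDegreeOne F) (k : ℤ) (x : T) :
    F ((L.τ ^ k : T ≃ₜ T) x) = (L.τ ^ k : T ≃ₜ T) (F x) := by
  induction k using Int.induction_on with
  | zero => simp
  | succ i ih =>
    rw [add_comm, zpow_add, zpow_one, Homeomorph.mul_apply, hF.map_τ, ih, Homeomorph.mul_apply]
  | pred i ih =>
    apply L.τ.injective
    have h1 : ∀ y, L.τ ((L.τ ^ (-(i : ℤ) - 1) : T ≃ₜ T) y) = (L.τ ^ (-(i : ℤ)) : T ≃ₜ T) y := by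
      intro y
      rw [← Homeomorph.mul_apply, ← zpow_one_add]; congr 2; ring
    rw [← hF.map_τ, h1, h1, ih]

theorem IsDegreeOne.iterate_τ_zpow (hF : L.IsDegreeOne F) (n : ℕ) (k : ℤ) (x : T) :
    F^[n] ((L.τ ^ k : T ≃ₜ T) x) = (L.τ ^ k : T ≃ₜ T) (F^[n] x) := by
  induction n with
  | zero => rfl
  | succ n ih => rw [Function.iterate_succ_apply', ih, hF.map_τ_zpow, Function.iterate_succ_apply']

/-- Left-combedness replaces the possibly off-line point `F^n t` by a real `w ≤ r (F^n t)` with the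
same next value; surjectivity of `G^n` on left half-lines pulls `w` back. -/
theorem exists_le_iterate_lineMap_eq (hF : L.IsDegreeOne F) (hcombed : L.Combed F) (t : T) (n : ℕ) :
    ∃ y ≤ L.r t, (L.lineMap F)^[n] y = L.r (F^[n] t) := by
  induction n with
  | zero => exact ⟨_, le_rfl, rfl⟩
  | succ n ih =>
    obtain ⟨y, hy, hyn⟩ := ih
    obtain ⟨_, ⟨w, hw, rfl⟩, hwF⟩ := (hcombed (L.r (F^[n] t))).1 ⟨F^[n] t, rfl, rfl⟩
    obtain ⟨y', hy', hyw⟩ := exists_le_map_eq_of_degree_one (hF.continuous_lineMap.iterate n)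
      (iterate_degree_one hF.lineMap_add_one n) (y := y) (w := w) (by rw [hyn]; exact hw)
    refine ⟨y', hy'.trans hy, ?_⟩
    rw [Function.iterate_succ_apply', hyw, Function.iterate_succ_apply']
    exact hwF

theorem exists_ge_iterate_lineMap_eq (hF : L.IsDegreeOne F) (hcombed : L.Combed F) (t : T) (n : ℕ) :
    ∃ y ≥ L.r t, (L.lineMap F)^[n] y = L.r (F^[n] t) := by
  induction n with
  | zero => exact ⟨_, le_rfl, rfl⟩
  | succ n ih =>
    obtain ⟨y, hy, hyn⟩ := ih
    obtain ⟨_, ⟨w, hw, rfl⟩, hwF⟩ := (hcombed (L.r (F^[n] t))).2 ⟨F^[n] t, rfl, rfl⟩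
    obtain ⟨y', hy', hyw⟩ := exists_ge_map_eq_of_degree_one (hF.continuous_lineMap.iterate n)
      (iterate_degree_one hF.lineMap_add_one n) (y := y) (w := w) (by rw [hyn]; exact hw)
    refine ⟨y', hy.trans hy', ?_⟩
    rw [Function.iterate_succ_apply', hyw, Function.iterate_succ_apply']
    exact hwF

theorem iterate_iterate_sub_int {G : ℝ → ℝ} (hG : ∀ x, G (x + 1) = G x + 1) (q : ℕ) (p : ℤ)
    (n : ℕ) (x : ℝ) : (fun y => G^[q] y - p)^[n] x = G^[q * n] x - n * p := by
  induction n with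
  | zero => simp
  | succ n ih =>
    have h := map_add_int_of_degree_one (iterate_degree_one hG q) (G^[q * n] x) (-(n * p))
    push_cast at h
    rw [Function.iterate_succ_apply', ih, sub_eq_add_neg (G^[q * n] x), h, mul_add, mul_one,
      add_comm (q * n), Function.iterate_add_apply]
    push_cast
    ring

/-- If every iterate of `F^q - p` keeps `t` below some level, its rotation number is at most
`p / q`. -/
theorem HasRotationNumber.le_of_forall_le {t : T} {α : ℝ} (h : L.HasRotationNumber F t α) {q : ℕ}
    (hq : 0 < q) {p : ℤ} {c : ℝ} (hc : ∀ n : ℕ, L.r (F^[q * n] t) - n * p ≤ c) :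
    α ≤ (p : ℝ) / q := by
  have hq' : (0 : ℝ) < q := by exact_mod_cast hq
  have h1 : Tendsto (fun n : ℕ => q * n) atTop atTop := tendsto_id.const_mul_atTop' hq
  have h2 : Tendsto (fun n : ℕ => (p : ℝ) / q + ((c - L.r t) / q) / (n : ℝ)) atTop
      (𝓝 ((p : ℝ) / q + 0)) := tendsto_const_nhds.add (tendsto_const_div_atTop_nhds_zero_nat _)
  rw [add_zero] at h2
  refine le_of_tendsto_of_tendsto (h.comp h1) h2 ?_
  filter_upwards [eventually_gt_atTop 0] with n hn
  have hn' : (0 : ℝ) < n := by exact_mod_cast hn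
  simp only [Function.comp_apply]
  push_cast
  have h3 : (p : ℝ) / q + (c - L.r t) / q / n = (n * p + (c - L.r t)) / (q * n) := by
    field_simp
  rw [h3]
  exact div_le_div_of_nonneg_right (by linarith [hc n]) (by positivity)

theorem HasRotationNumber.ge_of_forall_ge {t : T} {α : ℝ} (h : L.HasRotationNumber F t α) {q : ℕ}
    (hq : 0 < q) {p : ℤ} {c : ℝ} (hc : ∀ n : ℕ, c ≤ L.r (F^[q * n] t) - n * p) :
    (p : ℝ) / q ≤ α := by
  have hq' : (0 : ℝ) < q := by exact_mod_cast hq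
  have h1 : Tendsto (fun n : ℕ => q * n) atTop atTop := tendsto_id.const_mul_atTop' hq
  have h2 : Tendsto (fun n : ℕ => (p : ℝ) / q + ((c - L.r t) / q) / (n : ℝ)) atTop
      (𝓝 ((p : ℝ) / q + 0)) := tendsto_const_nhds.add (tendsto_const_div_atTop_nhds_zero_nat _)
  rw [add_zero] at h2
  refine le_of_tendsto_of_tendsto h2 (h.comp h1) ?_
  filter_upwards [eventually_gt_atTop 0] with n hn
  have hn' : (0 : ℝ) < n := by exact_mod_cast hn
  simp only [Function.comp_apply]
  push_cast
  have h3 : (p : ℝ) / q + (c - L.r t) / q / n = (n * p + (c - L.r t)) / (q * n) := by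
    field_simp
  rw [h3]
  exact div_le_div_of_nonneg_right (by linarith [hc n]) (by positivity)

/-- Otherwise `(-∞, x]` is invariant under `G^q - p`. So is an integer translate containing `r t`,
and it traps the real orbits that shadow `t`. -/
theorem exists_le_lt_map_of_lt_rotationNumber (hF : L.IsDegreeOne F) (hcombed : L.Combed F) {t : T}
    {α : ℝ} (h : L.HasRotationNumber F t α) {q : ℕ} (hq : 0 < q) {p : ℤ} (hα : (p : ℝ) / q < α)
    (x : ℝ) : ∃ y ≤ x, x < (L.lineMap F)^[q] y - p := by
  by_contra! hle
  refine hα.not_ge (h.le_of_forall_le hq (c := x + ⌈L.r t - x⌉) fun n => ?_)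
  have hinv : ∀ y ≤ x + ⌈L.r t - x⌉, (L.lineMap F)^[q] y - p ≤ x + ⌈L.r t - x⌉ := fun y hy => by
    have h1 := hle (y - ⌈L.r t - x⌉) (by linarith)
    have h2 := map_add_int_of_degree_one (iterate_degree_one hF.lineMap_add_one q)
      (y - ⌈L.r t - x⌉) ⌈L.r t - x⌉
    rw [sub_add_cancel] at h2
    linarith
  obtain ⟨y, hy, hyn⟩ := exists_le_iterate_lineMap_eq hF hcombed t (q * n)
  rw [← hyn, ← iterate_iterate_sub_int hF.lineMap_add_one]
  exact MapsTo.iterate (s := Iic (x + ⌈L.r t - x⌉)) hinv n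
    (show y ≤ _ by linarith [Int.le_ceil (L.r t - x)])

theorem exists_ge_map_lt_of_rotationNumber_lt (hF : L.IsDegreeOne F) (hcombed : L.Combed F) {t : T}
    {α : ℝ} (h : L.HasRotationNumber F t α) {q : ℕ} (hq : 0 < q) {p : ℤ} (hα : α < (p : ℝ) / q)
    (x : ℝ) : ∃ y ≥ x, (L.lineMap F)^[q] y - p < x := by
  by_contra! hle
  refine hα.not_ge (h.ge_of_forall_ge hq (c := x + ⌊L.r t - x⌋) fun n => ?_)
  have hinv : ∀ y ≥ x + ⌊L.r t - x⌋, (L.lineMap F)^[q] y - p ≥ x + ⌊L.r t - x⌋ := fun y hy => by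
    have h1 := hle (y - ⌊L.r t - x⌋) (by linarith)
    have h2 := map_add_int_of_degree_one (iterate_degree_one hF.lineMap_add_one q)
      (y - ⌊L.r t - x⌋) ⌊L.r t - x⌋
    rw [sub_add_cancel] at h2
    linarith
  obtain ⟨y, hy, hyn⟩ := exists_ge_iterate_lineMap_eq hF hcombed t (q * n)
  rw [← hyn, ← iterate_iterate_sub_int hF.lineMap_add_one]
  exact MapsTo.iterate (s := Ici (x + ⌊L.r t - x⌋)) hinv n
    (show _ ≤ y by linarith [Int.floor_le (L.r t - x)])

/-! ### Periodic points -/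

theorem hasRotationNumber_of_iterate_eq (hF : L.IsDegreeOne F) {x : T} {n : ℕ} (hn : 0 < n) {k : ℤ}
    (hx : F^[n] x = (L.τ ^ k : T ≃ₜ T) x) : L.HasRotationNumber F x ((k : ℝ) / n) := by
  have hn' : (0 : ℝ) < n := by exact_mod_cast hn
  -- Displacement minus linear drift is periodic in time, hence bounded.
  let β : ℕ → ℝ := fun i => L.r (F^[i] x) - L.r x - i * (k / n)
  have hper : Function.Periodic β n := fun i => by
    simp only [β]
    rw [Function.iterate_add_apply, hx, hF.iterate_τ_zpow, L.r_τ_zpow]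
    push_cast
    field_simp
    ring
  obtain ⟨B, hB⟩ : ∃ B, ∀ i, |β i| ≤ B := by
    obtain ⟨B, hB⟩ := ((finite_Iio n).image fun i => |β i|).bddAbove
    refine ⟨B, fun i => ?_⟩
    rw [← hper.map_mod_nat]
    exact hB ⟨i % n, Nat.mod_lt _ hn, rfl⟩
  have h0 : Tendsto (fun i : ℕ => β i / i) atTop (𝓝 0) := by
    refine squeeze_zero_norm (fun i => ?_) (tendsto_const_div_atTop_nhds_zero_nat B)
    rw [Real.norm_eq_abs, abs_div, Nat.abs_cast]
    exact div_le_div_of_nonneg_right (hB i) i.cast_nonneg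
  have h1 := h0.add_const ((k : ℝ) / n)
  rw [zero_add] at h1
  refine h1.congr' ?_
  filter_upwards [eventually_gt_atTop 0] with i hi
  have hi' : (i : ℝ) ≠ 0 := by exact_mod_cast hi.ne'
  simp only [β]
  field_simp
  ring

theorem exists_eq_mul_of_div_eq {p k : ℤ} {q n : ℕ} (hq : 0 < q) (hn : 0 < n)
    (hpq : Int.gcd p q = 1) (h : (k : ℝ) / n = (p : ℝ) / q) :
    ∃ d : ℕ, 0 < d ∧ n = q * d ∧ k = d * p := by
  have hq' : (q : ℝ) ≠ 0 := by exact_mod_cast hq.ne'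
  have hn' : (n : ℝ) ≠ 0 := by exact_mod_cast hn.ne'
  rw [div_eq_div_iff hn' hq'] at h
  have h' : k * q = p * n := by exact_mod_cast h
  have hdvd : (q : ℤ) ∣ n := by
    refine IsCoprime.dvd_of_dvd_mul_left (Int.isCoprime_iff_gcd_eq_one.2 hpq).symm ?_
    exact ⟨k, by rw [← h']; ring⟩
  obtain ⟨d, rfl⟩ := Int.natCast_dvd_natCast.1 hdvd
  refine ⟨d, Nat.pos_of_mul_pos_left hn, rfl, ?_⟩
  have hqz : (q : ℤ) ≠ 0 := by exact_mod_cast hq.ne'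
  apply mul_right_cancel₀ hqz
  rw [h']; push_cast; ring

theorem HasRotationNumber.unique {x : T} {α β : ℝ} (h : L.HasRotationNumber F x α)
    (h' : L.HasRotationNumber F x β) : α = β :=
  tendsto_nhds_unique h h'

/-- A periodic point of the induced map at which an iterate crosses a translate of the diagonal
upwards never leaves the line under `F`. -/
theorem iterate_h_eq_of_upcrossing (hF : L.IsDegreeOne F) {N : ℕ} {x c : ℝ}
    (hx : (L.lineMap F)^[N] x - c = x) (hup : ∀ᶠ y in 𝓝[>] x, y < (L.lineMap F)^[N] y - c)
    {i : ℕ} (hi : i ≤ N) : F^[i] (L.h x) = L.h ((L.lineMap F)^[i] x) := by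
  have hγ : Continuous fun s => F (L.h s) := hF.continuous.comp L.isEmbedding_h.continuous
  induction i with
  | zero => rfl
  | succ i ih =>
    rw [Function.iterate_succ_apply', ih (by omega), Function.iterate_succ_apply']
    by_cases hr : F (L.h ((L.lineMap F)^[i] x)) ∈ range L.h
    · exact (L.h_r hr).symm
    exfalso
    -- `r ∘ F ∘ h` is constant near the `i`-th orbit point, so `G^N` is constant near `x`, against
    -- the upcrossing.
    have h1 := ((hF.continuous_lineMap.iterate i).tendsto x).eventually
      (L.eventually_r_comp_eq hγ hr)
    have h2 : ∀ᶠ y in 𝓝[>] x, (L.lineMap F)^[N] y = (L.lineMap F)^[N] x := by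
      filter_upwards [nhdsWithin_le_nhds h1] with y hy
      obtain ⟨j, rfl⟩ := Nat.exists_eq_add_of_le' hi
      rw [Function.iterate_add_apply, Function.iterate_add_apply (n := i + 1),
        Function.iterate_succ_apply', Function.iterate_succ_apply']
      exact congrArg _ hy
    obtain ⟨y, ⟨hy1, hy2⟩, hy3⟩ := ((hup.and h2).and self_mem_nhdsWithin).exists
    rw [hy2, hx] at hy1
    exact lt_asymm hy1 hy3

theorem mul_mem_PerAt (hF : L.IsDegreeOne F) (hcombed : L.Combed F) {a b : ℝ}
    (hRot : L.Rot F = Icc a b) {p : ℤ} {q : ℕ} (hq : 0 < q) (hpq : Int.gcd p q = 1)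
    (hab : (p : ℝ) / q ∈ Ioo a b) {m : ℕ} (hm : 0 < m) : q * m ∈ L.PerAt ((p : ℝ) / q) F := by
  have hle : a ≤ b := (hab.1.trans hab.2).le
  obtain ⟨ta, hta⟩ : a ∈ L.Rot F := hRot ▸ left_mem_Icc.2 hle
  obtain ⟨tb, htb⟩ : b ∈ L.Rot F := hRot ▸ right_mem_Icc.2 hle
  have hit := iterate_iterate_sub_int hF.lineMap_add_one q p
  obtain ⟨x, hx, hmin, hup⟩ := exists_upcrossing_periodic
    (f := fun y => (L.lineMap F)^[q] y - p)
    ((hF.continuous_lineMap.iterate q).sub continuous_const)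
    (fun y => by rw [iterate_degree_one hF.lineMap_add_one]; ring)
    (exists_le_lt_map_of_lt_rotationNumber hF hcombed htb hq hab.2)
    (exists_ge_map_lt_of_rotationNumber_lt hF hcombed hta hq hab.1) hm
  simp only [hit] at hx hmin hup
  have horb : ∀ i ≤ q * m, F^[i] (L.h x) = L.h ((L.lineMap F)^[i] x) := fun i hi =>
    iterate_h_eq_of_upcrossing hF hx hup hi
  have hqm : 0 < q * m := Nat.mul_pos hq hm
  have hper : F^[q * m] (L.h x) = (L.τ ^ (m * p) : T ≃ₜ T) (L.h x) := by
    rw [horb _ le_rfl, L.τ_zpow_h]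
    congr 1
    push_cast
    linarith
  have hrot : L.HasRotationNumber F (L.h x) ((p : ℝ) / q) := by
    have := hasRotationNumber_of_iterate_eq hF hqm hper
    have hm' : (m : ℝ) ≠ 0 := by exact_mod_cast hm.ne'
    push_cast at this
    rwa [mul_comm (q : ℝ), mul_div_mul_left _ _ hm'] at this
  refine ⟨L.h x, ⟨⟨hqm, _, hper⟩, ?_⟩, hrot⟩
  rintro n ⟨hn, k, hk⟩
  by_contra! hlt
  -- A smaller period has rotation number `p/q` too, so it is `q * d` with translation `d * p`: then
  -- `x` returns under `G^q - p` after `d < m` steps.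
  obtain ⟨d, hd, rfl, rfl⟩ := exists_eq_mul_of_div_eq hq hn hpq
    ((hasRotationNumber_of_iterate_eq hF hn hk).unique hrot)
  refine hmin d hd (Nat.lt_of_mul_lt_mul_left hlt) ?_
  rw [horb _ hlt.le, L.τ_zpow_h] at hk
  have := L.isEmbedding_h.injective hk
  push_cast at this
  linarith

end LiftedSpace

theorem mainTheorem5 {T : Type*} [MetricSpace T] (L : LiftedSpace T) (F : T → T)
    (hF : L.IsDegreeOne F) (hcombed : L.Combed F) (a b : ℝ) (hRot : L.Rot F = Set.Icc a b) :
    (∀ (p : ℤ) (q : ℕ), 0 < q → Int.gcd p q = 1 → (p : ℝ) / (q : ℝ) ∈ Set.Ioo a b →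
      L.PerAt ((p : ℝ) / (q : ℝ)) F = {n : ℕ | ∃ m : ℕ, 0 < m ∧ n = q * m}) ∧
    L.Per F = L.PerAt a F ∪ denomSet a b ∪ L.PerAt b F := by
  refine ⟨fun p q hq hpq hab => ?_, ?_⟩
  · ext n
    constructor
    · rintro ⟨x, ⟨⟨hn, k, hk⟩, -⟩, hrot⟩
      obtain ⟨d, hd, rfl, -⟩ := LiftedSpace.exists_eq_mul_of_div_eq hq hn hpq
        ((LiftedSpace.hasRotationNumber_of_iterate_eq hF hn hk).unique hrot)
      exact ⟨d, hd, rfl⟩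
    · rintro ⟨m, hm, rfl⟩
      exact LiftedSpace.mul_mem_PerAt hF hcombed hRot hq hpq hab hm
  · ext n
    constructor
    · rintro ⟨x, hx⟩
      obtain ⟨hn, k, hk⟩ := hx.1
      have hrot := LiftedSpace.hasRotationNumber_of_iterate_eq hF hn hk
      have hmem : (k : ℝ) / n ∈ Set.Icc a b := hRot ▸ ⟨x, hrot⟩
      rcases hmem.1.eq_or_lt with ha | ha
      · exact Or.inl (Or.inl ⟨x, hx, ha ▸ hrot⟩)
      rcases hmem.2.eq_or_lt with hb | hb
      · exact Or.inr ⟨x, hx, hb ▸ hrot⟩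
      exact Or.inl (Or.inr ⟨hn, k, ha, hb⟩)
    · rintro ((⟨x, hx, -⟩ | ⟨hn, k, ha, hb⟩) | ⟨x, hx, -⟩)
      · exact ⟨x, hx⟩
      -- Reduce `k/n` to `p/q`; then `n = q * g` with `g` the gcd, and the period `q * g` occurs at
      -- `p/q`.
      · have hg : 0 < Int.gcd k n := Int.gcd_pos_of_ne_zero_right _ (by exact_mod_cast hn.ne')
        obtain ⟨p, hp⟩ : (Int.gcd k n : ℤ) ∣ k := Int.gcd_dvd_left ..
        obtain ⟨q, hqn⟩ : Int.gcd k n ∣ n := by exact_mod_cast Int.gcd_dvd_right k n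
        set g := Int.gcd k n with hgdef
        have hq : 0 < q := Nat.pos_of_mul_pos_left (hqn ▸ hn)
        have hpq : Int.gcd p q = 1 := by
          have : Int.gcd (g * p) (g * q) = g := by
            rw [← hp]
            conv_rhs => rw [hgdef, hqn]
            push_cast
            rfl
          rw [Int.gcd_mul_left] at this
          simpa [hg.ne'] using this
        have hkn : (k : ℝ) / n = (p : ℝ) / q := by
          have hg' : (g : ℝ) ≠ 0 := by exact_mod_cast hg.ne'
          rw [hp, hqn]
          push_cast
          exact mul_div_mul_left _ _ hg'
        obtain ⟨x, hx, -⟩ := LiftedSpace.mul_mem_PerAt hF hcombed hRot hq hpq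
          (hkn ▸ ⟨ha, hb⟩) hg
        exact ⟨x, by rwa [hqn, mul_comm]⟩
      · exact ⟨x, hx⟩
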